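/- Let $n,k,c\ge 0$ be integers with $k+c\le n$, and let $U$ be an $n$-qubit Clifford unitary (conjugation by $U$ maps the $n$-qubit Pauli group into itself). Consider the $[[n,k;c]]$ entanglement-assisted quantum error-correcting (EAQEC) code with encoder $U$: a $k$-qubit state $|\psi\rangle$ is encoded as $(U^A\otimes I^B)\,(|\psi\rangle\otimes|\Phi_+\rangle^{\otimes c}\otimes|0\rangle^{\otimes(n-k-c)})$, where each ebit $|\Phi_+\rangle=(|00\rangle+|11\rangle)/\sqrt2$ has one qubit on Alice's side and one on Bob's; thus Alice holds $n$ qubits and Bob holds $c$ qubits. Let $\mathcal U$ be this encoding channel. Put $g'_j=UZ_jU^\dagger$ and $h'_j=UX_jU^\dagger$, and let $\mathcal S$ be the stabilizer group on $n+c$ qubits generated by the $n-k+c$ operators $g'_{k+i}\otimes Z_i$ and $h'_{k+i}\otimes X_i$ ($1\le i\le c$) and $g'_j\otimes I$ ($k+c<j\le n$); call these generators $g_1,\dots,g_{n-k+c}$. An error operator (a tensor product of $n+c$ matrices from $\{I,X,Y,Z\}$) has syndrome $s\in\{0,1\}^{n-k+c}$ where $s_j=0$ if it commutes with $g_j$ and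 $s_j=1$ otherwise. For each $s$ let $E_s$ be an error operator with syndrome $s$, with $E_0=I$, and let $T=\{E_s\}$ be this set of syndrome representatives. The decoding channel $\mathcal D$ measures the syndrome with the projectors $P_s=\prod_j\frac{I+(-1)^{s_j}g_j}{2}$, applies $E_s$ when the result is $s$, applies $U^\dagger\otimes I$, and traces out all qubits except the $k$ information qubits. Let $\mathcal T_p(\rho)=(1-\frac34p)\rho+\frac p4(X\rho X+Y\rho Y+Z\rho Z)$ be the depolarizing channel, let $p_a,p_b\in[0,1]$, $\mathcal N_A=\mathcal T_{p_a}^{\otimes n}$ and $\mathcal N_B=\mathcal T_{p_b}^{\otimes c}$. For a channel $\mathcal E$ on an $m$-dimensional space let $F_C(\mathcal E)=\langle\phi|(I\otimes\mathcal E)(|\phi\rangle\langle\phi|)|\phi\rangle$ with $|\phi\rangle=m^{-1/2}\sum_j|j\rangle|j\rangle$. Then $$F_C\big(\mathcal D\,(\mathcal N_A\otimes\mathcal N_B)\,\mathcal U\big)=\sum_{w=0}^{n}\sum_{w'=0}^{c}a_{w,w'}\,q_w\,r_{w'},$$ where $$q_w=\Big(1-\tfrac34p_a\Big)^{n-w}\Big(\tfrac14p_a\Big)^{w},\qquad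 r_{w'}=\Big(1-\tfrac34p_b\Big)^{c-w'}\Big(\tfrac14p_b\Big)^{w'},$$ and $a_{w,w'}$ is the number of error operators $E_A\otimes E_B$ that lie, up to an overall phase, in $T\times\mathcal S=\{hg: h\in T,\ g\in\mathcal S\}$ and for which $E_A$ (on Alice's $n$ qubits) has weight $w$ and $E_B$ (on Bob's $c$ qubits) has weight $w'$, the weight being the number of tensor factors different from $I$. -/

import Mathlib

open scoped Matrix Kronecker

noncomputable section

namespace EAQ

/-! ### Pauli operators -/

/-- The labels of the four single-qubit Pauli operators. -/
inductive Pauli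
  | I | X | Y | Z
  deriving DecidableEq

instance : Fintype Pauli := ⟨{.I, .X, .Y, .Z}, by intro P; cases P <;> simp⟩

/-- The matrices of the single-qubit Pauli operators in the computational basis. -/
def Pauli.mat : Pauli → Matrix (Fin 2) (Fin 2) ℂ
  | .I => 1
  | .X => !![0, 1; 1, 0]
  | .Y => !![0, -Complex.I; Complex.I, 0]
  | .Z => !![1, 0; 0, -1]

theorem Pauli.mat_mul_self (P : Pauli) : P.mat * P.mat = 1 := by
  cases P <;> ext i j <;> fin_cases i <;> fin_cases j <;>
    simp [Pauli.mat, Matrix.mul_apply, Fin.sum_univ_two]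

theorem Pauli.conj_mat (P : Pauli) (i j : Fin 2) : star (P.mat j i) = P.mat i j := by
  cases P <;> fin_cases i <;> fin_cases j <;> simp [Pauli.mat]

section Registers

variable {ι : Type} [Fintype ι] [DecidableEq ι]

/-- The operator `⨂ i, P i` on a register of qubits indexed by `ι`, whose computational basis
is indexed by `ι → Fin 2`. -/
def pauliMat (P : ι → Pauli) : Matrix (ι → Fin 2) (ι → Fin 2) ℂ :=
  fun x y => ∏ i, (P i).mat (x i) (y i)

theorem pauliMat_mul_self (P : ι → Pauli) : pauliMat P * pauliMat P = 1 := by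
  ext x y
  simp only [pauliMat, Matrix.mul_apply, ← Finset.prod_mul_distrib]
  rw [← Fintype.prod_sum (fun i b => (P i).mat (x i) b * (P i).mat b (y i))]
  simp only [← Matrix.mul_apply, Pauli.mat_mul_self, Matrix.one_apply]
  rw [Finset.prod_ite_zero]
  simp [funext_iff]

/-- The tensor product `⨂ i, P i` as a unitary. -/
def pauli (P : ι → Pauli) : Matrix.unitaryGroup (ι → Fin 2) ℂ :=
  ⟨pauliMat P, by
    have h : star (pauliMat P) = pauliMat P := by
      ext x y
      simp only [Matrix.star_apply, pauliMat, star_prod, Pauli.conj_mat]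
    rw [Matrix.mem_unitaryGroup_iff, h, pauliMat_mul_self]⟩

/-- The operator that acts as `P` on the qubit `i` and trivially on the other qubits. -/
def pauliAt (i : ι) (P : Pauli) : Matrix.unitaryGroup (ι → Fin 2) ℂ :=
  pauli (Function.update (fun _ => Pauli.I) i P)

/-- The Pauli group of a register: tensor products of Pauli operators, with a phase
in `{1, i, -1, -i}`. -/
def pauliGroup (ι : Type) [Fintype ι] [DecidableEq ι] :
    Set (Matrix.unitaryGroup (ι → Fin 2) ℂ) :=
  {g | ∃ (z : ℂ) (P : ι → Pauli), z ^ 4 = 1 ∧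
    (g : Matrix (ι → Fin 2) (ι → Fin 2) ℂ) = z • pauliMat P}

/-- The weight: the number of tensor factors different from the identity. -/
def weight (P : ι → Pauli) : ℕ := (Finset.univ.filter fun i => P i ≠ Pauli.I).card

end Registers

/-- The tensor product of two unitaries. -/
def kronU {m n : Type} [Fintype m] [DecidableEq m] [Fintype n] [DecidableEq n]
    (A : Matrix.unitaryGroup m ℂ) (B : Matrix.unitaryGroup n ℂ) :
    Matrix.unitaryGroup (m × n) ℂ :=
  ⟨(A : Matrix m m ℂ) ⊗ₖ (B : Matrix n n ℂ), Matrix.kronecker_mem_unitary A.2 B.2⟩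

/-! ### Superoperators and the channel fidelity -/

/-- Linear maps from operators on `ℂ^m` to operators on `ℂ^n`. -/
abbrev SuperOp (m n : Type) : Type := Matrix m m ℂ →ₗ[ℂ] Matrix n n ℂ

/-- The map `ρ ↦ V ρ V†`. -/
def conjBy {m n : Type} [Fintype m] (V : Matrix n m ℂ) : SuperOp m n where
  toFun ρ := V * ρ * Vᴴ
  map_add' ρ σ := by rw [Matrix.mul_add, Matrix.add_mul]
  map_smul' a ρ := by simp

/-- The tensor product `Φ ⊗ Ψ` of two superoperators, in terms of matrix units: the linear map
that sends `A ⊗ B` to `Φ A ⊗ Ψ B`. -/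
def tensorOp {m n m' n' : Type} [Fintype m] [DecidableEq m] [Fintype n] [DecidableEq n]
    (Φ : SuperOp m m') (Ψ : SuperOp n n') : SuperOp (m × n) (m' × n') where
  toFun ρ := ∑ a, ∑ a', ∑ b, ∑ b',
    ρ (a, b) (a', b') • (Φ (Matrix.single a a' 1) ⊗ₖ Ψ (Matrix.single b b' 1))
  map_add' ρ σ := by simp [add_smul, Finset.sum_add_distrib]
  map_smul' z ρ := by simp [mul_smul, Finset.smul_sum]

/-- The tensor power `Φ^{⊗ι}` of a single-qubit superoperator, in terms of matrix units:
the linear map that sends `⨂ i, A i` to `⨂ i, Φ (A i)`. -/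
def tensorPow (ι : Type) [Fintype ι] [DecidableEq ι] (Φ : SuperOp (Fin 2) (Fin 2)) :
    SuperOp (ι → Fin 2) (ι → Fin 2) where
  toFun ρ := Matrix.of fun x x' => ∑ y, ∑ y',
    ρ y y' * ∏ i, Φ (Matrix.single (y i) (y' i) 1) (x i) (x' i)
  map_add' ρ σ := by ext; simp [add_mul, Finset.sum_add_distrib]
  map_smul' z ρ := by ext; simp [mul_assoc, Finset.mul_sum]

/-- The maximally entangled vector `m^{-1/2} ∑ j, |j⟩|j⟩`, where `m` is the dimension. -/
def maxEntangled (d : Type) [Fintype d] [DecidableEq d] : d × d → ℂ :=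
  fun x => if x.1 = x.2 then ((1 / √(Fintype.card d : ℝ) : ℝ) : ℂ) else 0

/-- The channel fidelity `⟨ψ| (I ⊗ 𝓔)(|ψ⟩⟨ψ|) |ψ⟩` with `ψ` maximally entangled. -/
def channelFidelity {d : Type} [Fintype d] [DecidableEq d] (𝓔 : SuperOp d d) : ℂ :=
  star (maxEntangled d) ⬝ᵥ
    (tensorOp LinearMap.id 𝓔
      (Matrix.vecMulVec (maxEntangled d) (star (maxEntangled d))) *ᵥ maxEntangled d)

/-- The single-qubit depolarizing channel of rate `p`. -/
def depolarizing (p : ℝ) : SuperOp (Fin 2) (Fin 2) :=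
  ((1 - 3 / 4 * p : ℝ) : ℂ) • LinearMap.id +
    ((p / 4 : ℝ) : ℂ) •
      (conjBy Pauli.X.mat + conjBy Pauli.Y.mat + conjBy Pauli.Z.mat)

/-- The probability of each error operator of weight `w` under the depolarizing channel of
rate `p` acting independently on `n` qubits. -/
def errorProb (n : ℕ) (p : ℝ) (w : ℕ) : ℝ := (1 - 3 / 4 * p) ^ (n - w) * (1 / 4 * p) ^ w

/-! ### Entanglement-assisted codes -/

/-- Alice's `n` qubits: `k` information qubits, her halves of the `c` ebits, and
`n - k - c` ancillas (for `k + c ≤ n`). -/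
abbrev Alice (n k c : ℕ) : Type := Fin k ⊕ Fin c ⊕ Fin (n - k - c)

/-- Basis labels of the joint register: Alice's `n` qubits and Bob's halves of the `c` ebits. -/
abbrev Joint (n k c : ℕ) : Type := (Alice n k c → Fin 2) × (Fin c → Fin 2)

/-- Labels of the error operators `E_A ⊗ E_B` on the joint register. -/
abbrev JointError (n k c : ℕ) : Type := (Alice n k c → Pauli) × (Fin c → Pauli)

/-- The error operator `E_A ⊗ E_B`. -/
def jointPauli {n k c : ℕ} (E : JointError n k c) : Matrix.unitaryGroup (Joint n k c) ℂ :=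
  kronU (pauli E.1) (pauli E.2)

/-- Indices of the `n - k + c` stabilizer generators: one `Z`-type and one `X`-type generator
for each ebit, and one `Z`-type generator for each ancilla. -/
abbrev Gen (n k c : ℕ) : Type := Fin c ⊕ Fin c ⊕ Fin (n - k - c)

/-- Error syndromes. -/
abbrev Syndrome (n k c : ℕ) : Type := Gen n k c → Fin 2

/-- An `[[n, k; c]]` entanglement-assisted code, given by a Clifford encoder on Alice's
qubits. -/
structure Code (n k c : ℕ) where
  le : k + c ≤ n
  /-- The encoding unitary. -/
  U : Matrix.unitaryGroup (Alice n k c → Fin 2) ℂ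
  clifford : ∀ g ∈ pauliGroup (Alice n k c), U * g * U⁻¹ ∈ pauliGroup (Alice n k c)

namespace Code

variable {n k c : ℕ} (C : Code n k c)

/-- `g'_j = U Z_j U†`. -/
def g' (j : Alice n k c) : Matrix.unitaryGroup (Alice n k c → Fin 2) ℂ :=
  C.U * pauliAt j Pauli.Z * C.U⁻¹

/-- `h'_j = U X_j U†`. -/
def h' (j : Alice n k c) : Matrix.unitaryGroup (Alice n k c → Fin 2) ℂ :=
  C.U * pauliAt j Pauli.X * C.U⁻¹

/-- The stabilizer generators on `n + c` qubits: `g'_i ⊗ Z_i` and `h'_i ⊗ X_i` for the ebits,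
and `g'_j ⊗ I` for the ancillas. -/
def gen : Gen n k c → Matrix.unitaryGroup (Joint n k c) ℂ
  | .inl i => kronU (C.g' (.inr (.inl i))) (pauliAt i Pauli.Z)
  | .inr (.inl i) => kronU (C.h' (.inr (.inl i))) (pauliAt i Pauli.X)
  | .inr (.inr j) => kronU (C.g' (.inr (.inr j))) 1

/-- The stabilizer group `𝒮` on `n + c` qubits. -/
def stabilizer : Subgroup (Matrix.unitaryGroup (Joint n k c) ℂ) :=
  Subgroup.closure (Set.range C.gen)

/-- `E` has error syndrome `s`: `s j = 0` exactly if `E` commutes with the generator `j`. -/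
def HasSyndrome (E : JointError n k c) (s : Syndrome n k c) : Prop :=
  ∀ j, s j = 0 ↔ Commute (jointPauli E) (C.gen j)

/-- A choice of syndrome representatives: a Pauli operator with syndrome `s` for each `s`, the
identity for `s = 0`. -/
structure IsSyndromeReps (R : Syndrome n k c → JointError n k c) : Prop where
  hasSyndrome : ∀ s, C.HasSyndrome (R s) s
  zero : R 0 = (fun _ => Pauli.I, fun _ => Pauli.I)

/-- The factor `(I + (-1)^{s j} g_j) / 2` of the syndrome projector. -/
def projFactor (s : Syndrome n k c) (j : Gen n k c) :
    Matrix (Joint n k c) (Joint n k c) ℂ :=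
  (1 / 2 : ℂ) • (1 + (-1 : ℂ) ^ (s j : ℕ) • (C.gen j : Matrix (Joint n k c) (Joint n k c) ℂ))

/-- The syndrome projector `P_s`, the product of the factors `(I + (-1)^{s j} g_j) / 2` over
all generators (they commute, so the order is immaterial). -/
def proj (s : Syndrome n k c) : Matrix (Joint n k c) (Joint n k c) ℂ :=
  ((List.finRange c).map fun i => C.projFactor s (.inl i)).prod *
  ((List.finRange c).map fun i => C.projFactor s (.inr (.inl i))).prod *
  ((List.finRange (n - k - c)).map fun j => C.projFactor s (.inr (.inr j))).prod

/-- The isometry `|ψ⟩ ↦ |ψ⟩ ⊗ |Φ₊⟩^{⊗c} ⊗ |0⟩^{⊗(n-k-c)}`, with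
`|Φ₊⟩ = (|00⟩ + |11⟩)/√2` shared between Alice and Bob. -/
def initial (n k c : ℕ) : Matrix (Joint n k c) (Fin k → Fin 2) ℂ :=
  Matrix.of fun x y =>
    (if (fun i => x.1 (.inl i)) = y then 1 else 0) *
    (∏ i : Fin c, if x.1 (.inr (.inl i)) = x.2 i then ((1 / √2 : ℝ) : ℂ) else 0) *
    (if ∀ j, x.1 (.inr (.inr j)) = 0 then 1 else 0)

/-- The unitary `U ⊗ I`. -/
def UAB : Matrix.unitaryGroup (Joint n k c) ℂ := kronU C.U 1

/-- The encoding channel. -/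
def encode : SuperOp (Fin k → Fin 2) (Joint n k c) :=
  conjBy ((C.UAB : Matrix (Joint n k c) (Joint n k c) ℂ) * initial n k c)

/-- The partial trace over all the qubits but the `k` information qubits. -/
def traceOut (n k c : ℕ) : SuperOp (Joint n k c) (Fin k → Fin 2) where
  toFun ρ := Matrix.of fun y y' =>
    ∑ e : Fin c → Fin 2, ∑ a : Fin (n - k - c) → Fin 2, ∑ b : Fin c → Fin 2,
      ρ (Sum.elim y (Sum.elim e a), b) (Sum.elim y' (Sum.elim e a), b)
  map_add' ρ σ := by ext; simp [Finset.sum_add_distrib]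
  map_smul' z ρ := by ext; simp [Finset.mul_sum]

/-- The decoding channel: syndrome measurement, correction by the representative of the
measured syndrome, inverse of the encoding unitary, partial trace. -/
def decode (R : Syndrome n k c → JointError n k c) : SuperOp (Joint n k c) (Fin k → Fin 2) :=
  traceOut n k c ∘ₗ ∑ s, conjBy
    (((C.UAB)⁻¹ : Matrix.unitaryGroup (Joint n k c) ℂ).1 * (jointPauli (R s)).1 * C.proj s)

/-- The error operators `E_A ⊗ E_B` that lie in `T × 𝒮 = {h g : h ∈ T, g ∈ 𝒮}` up to an overall
phase, where `T` is the set of syndrome representatives. -/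
def correctable (R : Syndrome n k c → JointError n k c) : Set (JointError n k c) :=
  {E | ∃ h ∈ Set.range R, ∃ g ∈ C.stabilizer, ∃ z : ℂ, z ^ 4 = 1 ∧
    (jointPauli E).1 = z • ((jointPauli h).1 * g.1)}

/-- The number of elements of `T × 𝒮` (up to phase) that have weight `w` on Alice's qubits and
weight `w'` on Bob's qubits. -/
def weightCount (R : Syndrome n k c → JointError n k c) (w w' : ℕ) : ℕ :=
  {E ∈ C.correctable R | weight E.1 = w ∧ weight E.2 = w'}.ncard

end Code

/-- The channel `𝒩_A ⊗ 𝒩_B`: depolarizing of rate `pa` on each of Alice's qubits and of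
rate `pb` on each of Bob's. -/
def noise (n k c : ℕ) (pa pb : ℝ) : SuperOp (Joint n k c) (Joint n k c) :=
  tensorOp (tensorPow (Alice n k c) (depolarizing pa)) (tensorPow (Fin c) (depolarizing pb))

end EAQ

end

/-!
The channel fidelity of an operator `ρ ↦ V ρ V†` is `|tr V|² / d²`, and the fidelity is linear in
the channel. The depolarizing noise is a mixture of the Pauli errors `E_A ⊗ E_B`
(`EAQ.noise_eq`), whose probabilities depend only on the two weights, so it suffices to see that
decoding after the error `E` has fidelity `1` if `E` is correctable and `0` otherwise
(`EAQ.Code.channelFidelity_error`). The weight enumerator then comes from collecting the correctable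
errors by weight (`EAQ.sum_jointProb_mem`).

Let `W` be the encoding isometry; stabilizer elements fix it. If `E` has syndrome `t`, the columns
of `E W` are joint eigenvectors of the generators, so only the projector `P_t` contributes and the
decoder applies `U† R_t` to `E W` (`EAQ.Code.decode_comp_conjBy`).

* If `E` is a phase times `R_s g` with `g` in the stabilizer, then `E W` is a phase times `R_s W`,
  and the decoder returns the initial state.
* In general `R_t E` commutes with all the generators. Since the Clifford unitary `U` permutes the
  Pauli operators up to phases, `U† R_t E U` is, up to a phase, a Pauli operator that commutes with
  `Z ⊗ Z` and `X ⊗ X` on each ebit and with `Z` on each ancilla. It therefore acts by the same Pauli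
  operator on the two halves of each ebit and by `I` or `Z` on each ancilla, hence is a logical
  Pauli operator `L` times an element of the stabilizer group of the trivially encoded code
  (`EAQ.exists_logical`). The effect of decoding is conjugation by `L`. When `L` is the identity,
  `E` is correctable; otherwise `L` is traceless and the fidelity vanishes.

Pauli labels carry the structure of an elementary abelian `2`-group, and all operator identities are
tracked up to fourth roots of unity.
-/

noncomputable section

namespace EAQ

/-! ### The Klein four-group of Pauli labels -/

/-- The product of two Pauli operators, forgetting the phase. -/
def Pauli.mul : Pauli → Pauli → Pauli
  | .I, P => P
  | P, .I => P
  | .X, .X => .I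
  | .X, .Y => .Z
  | .X, .Z => .Y
  | .Y, .X => .Z
  | .Y, .Y => .I
  | .Y, .Z => .X
  | .Z, .X => .Y
  | .Z, .Y => .X
  | .Z, .Z => .I

/-- The Pauli operators modulo phases form a Klein four-group. By the `Pi` and `Prod` instances,
the labels of error operators form an elementary abelian `2`-group as well. -/
instance : CommGroup Pauli where
  mul := Pauli.mul
  one := .I
  inv := id
  mul_assoc := by decide
  one_mul := by decide
  mul_one := by decide
  mul_comm := by decide
  inv_mul_cancel := by decide

theorem Pauli.one_eq : (1 : Pauli) = Pauli.I := rfl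

theorem Pauli.mat_one : (1 : Pauli).mat = 1 := rfl

/-- The phase of a product of two Pauli operators. -/
def Pauli.phase : Pauli → Pauli → ℂ
  | .X, .Y => Complex.I
  | .Y, .Z => Complex.I
  | .Z, .X => Complex.I
  | .Y, .X => -Complex.I
  | .Z, .Y => -Complex.I
  | .X, .Z => -Complex.I
  | _, _ => 1

theorem Pauli.phase_pow (P Q : Pauli) : P.phase Q ^ 4 = 1 := by
  cases P <;> cases Q <;> simp [Pauli.phase, Even.neg_pow (n := 4) (by decide)]

theorem Pauli.mat_mul (P Q : Pauli) : P.mat * Q.mat = P.phase Q • (P * Q).mat := by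
  change _ = _ • (Pauli.mul P Q).mat
  cases P <;> cases Q <;> ext i j <;> fin_cases i <;> fin_cases j <;>
    simp [Pauli.mat, Pauli.phase, Pauli.mul, Matrix.mul_apply, Fin.sum_univ_two]

/-- The commutation sign of two Pauli operators: `1` if they commute and `-1` if they
anticommute. -/
def Pauli.sign (P Q : Pauli) : ℤ := if P = .I ∨ Q = .I ∨ P = Q then 1 else -1

theorem Pauli.mat_comm (P Q : Pauli) : P.mat * Q.mat = (P.sign Q : ℂ) • (Q.mat * P.mat) := by
  cases P <;> cases Q <;> ext i j <;> fin_cases i <;> fin_cases j <;>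
    simp [Pauli.mat, Pauli.sign, Matrix.mul_apply, Fin.sum_univ_two]

theorem Pauli.sign_one_right (P : Pauli) : P.sign 1 = 1 := by cases P <;> rfl

theorem Pauli.trace_mat_of_ne {P : Pauli} (h : P ≠ 1) : P.mat.trace = 0 := by
  cases P
  · exact absurd rfl h
  all_goals simp [Pauli.mat, Matrix.trace, Fin.sum_univ_two]

theorem ne_zero_of_pow_four_eq_one {z : ℂ} (hz : z ^ 4 = 1) : z ≠ 0 := by
  rintro rfl
  norm_num at hz

section Registers

variable {ι : Type} [Fintype ι] [DecidableEq ι]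

theorem pauliMat_mul_apply (P Q : ι → Pauli) (x y : ι → Fin 2) :
    (pauliMat P * pauliMat Q) x y = ∏ i, ((P i).mat * (Q i).mat) (x i) (y i) := by
  simp only [pauliMat, Matrix.mul_apply, ← Finset.prod_mul_distrib]
  exact (Fintype.prod_sum (fun i b => (P i).mat (x i) b * (Q i).mat b (y i))).symm

omit [DecidableEq ι] in
theorem pauliMat_one : pauliMat (1 : ι → Pauli) = 1 := by
  ext x y
  simp only [pauliMat, Pi.one_apply, Pauli.mat_one, Matrix.one_apply]
  rw [Finset.prod_ite_zero]
  simp [funext_iff]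

theorem exists_pauliMat_mul (P Q : ι → Pauli) :
    ∃ z : ℂ, z ^ 4 = 1 ∧ pauliMat P * pauliMat Q = z • pauliMat (P * Q) := by
  refine ⟨∏ i, (P i).phase (Q i), ?_, ?_⟩
  · simp [← Finset.prod_pow, Pauli.phase_pow]
  · ext x y
    simp [pauliMat_mul_apply, Pauli.mat_mul, Finset.prod_mul_distrib, pauliMat]

theorem pauliMat_comm (P Q : ι → Pauli) :
    pauliMat P * pauliMat Q =
      ((∏ i, (P i).sign (Q i) : ℤ) : ℂ) • (pauliMat Q * pauliMat P) := by
  ext x y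
  rw [Matrix.smul_apply]
  simp only [pauliMat_mul_apply]
  simp_rw [fun i => Pauli.mat_comm (P i) (Q i)]
  simp [Finset.prod_mul_distrib]

theorem trace_pauliMat (P : ι → Pauli) : (pauliMat P).trace = ∏ i, (P i).mat.trace := by
  simp only [Matrix.trace, Matrix.diag_apply, pauliMat]
  exact (Fintype.prod_sum (fun i b => (P i).mat b b)).symm

theorem trace_pauliMat_of_ne {P : ι → Pauli} (h : P ≠ 1) : (pauliMat P).trace = 0 := by
  obtain ⟨i, hi⟩ := Function.ne_iff.1 h
  rw [trace_pauliMat]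
  exact Finset.prod_eq_zero (Finset.mem_univ i) (Pauli.trace_mat_of_ne hi)

/-- Tensor products of Pauli operators are determined up to a factor by their labels. -/
theorem eq_of_pauliMat_eq_smul {P Q : ι → Pauli} {z : ℂ}
    (h : pauliMat P = z • pauliMat Q) : P = Q := by
  have hinv : Q⁻¹ = Q := rfl
  by_contra hne
  have hPQ : P * Q ≠ 1 := fun h1 => hne (by rw [mul_eq_one_iff_eq_inv.1 h1, hinv])
  obtain ⟨y, -, hy⟩ := exists_pauliMat_mul P Q
  have h2 := congrArg Matrix.trace hy
  rw [Matrix.trace_smul, trace_pauliMat_of_ne hPQ, h, Matrix.smul_mul, pauliMat_mul_self,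
    Matrix.trace_smul, Matrix.trace_one] at h2
  have hz : z = 0 := by simpa using h2
  have h3 := pauliMat_mul_self P
  rw [h, hz, zero_smul, zero_mul] at h3
  exact zero_ne_one h3

theorem pauliAt_eq_mulSingle (i : ι) (P : Pauli) : pauliAt i P = pauli (Pi.mulSingle i P) := rfl

end Registers

/-! ### Error operators on the joint register -/

theorem kronU_mul {m n : Type} [Fintype m] [DecidableEq m] [Fintype n] [DecidableEq n]
    (A A' : Matrix.unitaryGroup m ℂ) (B B' : Matrix.unitaryGroup n ℂ) :
    kronU A B * kronU A' B' = kronU (A * A') (B * B') :=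
  Subtype.ext (Matrix.mul_kronecker_mul _ _ _ _).symm

theorem kronU_one {m n : Type} [Fintype m] [DecidableEq m] [Fintype n] [DecidableEq n] :
    kronU (1 : Matrix.unitaryGroup m ℂ) (1 : Matrix.unitaryGroup n ℂ) = 1 :=
  Subtype.ext Matrix.one_kronecker_one

theorem pauli_one {ι : Type} [Fintype ι] [DecidableEq ι] : pauli (1 : ι → Pauli) = 1 :=
  Subtype.ext pauliMat_one

variable {n k c : ℕ}

/-- The matrix of `E_A ⊗ E_B`. -/
abbrev jointMat (E : JointError n k c) : Matrix (Joint n k c) (Joint n k c) ℂ :=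
  (jointPauli E).1

theorem jointMat_def (E : JointError n k c) : jointMat E = pauliMat E.1 ⊗ₖ pauliMat E.2 := rfl

theorem jointMat_one : jointMat (1 : JointError n k c) = 1 := by
  rw [jointMat_def, Prod.fst_one, Prod.snd_one, pauliMat_one, pauliMat_one,
    Matrix.one_kronecker_one]

theorem jointMat_mul_self (E : JointError n k c) : jointMat E * jointMat E = 1 := by
  rw [jointMat_def, ← Matrix.mul_kronecker_mul, pauliMat_mul_self, pauliMat_mul_self,
    Matrix.one_kronecker_one]

theorem exists_jointMat_mul (E F : JointError n k c) :
    ∃ z : ℂ, z ^ 4 = 1 ∧ jointMat E * jointMat F = z • jointMat (E * F) := by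
  obtain ⟨y, hy, h⟩ := exists_pauliMat_mul E.1 F.1
  obtain ⟨z, hz, h'⟩ := exists_pauliMat_mul E.2 F.2
  refine ⟨y * z, by rw [mul_pow, hy, hz, one_mul], ?_⟩
  rw [jointMat_def, jointMat_def, ← Matrix.mul_kronecker_mul, h, h', Matrix.smul_kronecker,
    Matrix.kronecker_smul, smul_smul, jointMat_def, Prod.fst_mul, Prod.snd_mul]

/-- The commutation sign of two error operators. -/
def jointSign (E F : JointError n k c) : ℤ :=
  (∏ i, (E.1 i).sign (F.1 i)) * ∏ i, (E.2 i).sign (F.2 i)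

theorem jointMat_comm (E F : JointError n k c) :
    jointMat E * jointMat F = (jointSign E F : ℂ) • (jointMat F * jointMat E) := by
  rw [jointMat_def, jointMat_def, ← Matrix.mul_kronecker_mul, pauliMat_comm E.1,
    pauliMat_comm E.2, Matrix.smul_kronecker, Matrix.kronecker_smul, smul_smul, jointSign,
    ← Matrix.mul_kronecker_mul, Int.cast_mul]

theorem jointSign_eq_or (E F : JointError n k c) : jointSign E F = 1 ∨ jointSign E F = -1 := by
  have h1 : ∀ P Q : Pauli, P.sign Q * P.sign Q = 1 := by decide
  refine mul_self_eq_one_iff.1 ?_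
  rw [jointSign, mul_mul_mul_comm, ← Finset.prod_mul_distrib, ← Finset.prod_mul_distrib]
  simp [h1]

theorem jointMat_ne_zero (E : JointError n k c) : jointMat E ≠ 0 := fun h => by
  have h2 := jointMat_mul_self E
  rw [h, zero_mul] at h2
  exact zero_ne_one h2

theorem jointSign_eq_one_of_commute {E F : JointError n k c}
    (h : Commute (jointMat E) (jointMat F)) : jointSign E F = 1 := by
  rcases jointSign_eq_or E F with h1 | h1
  · exact h1
  · have h2 := jointMat_comm E F
    rw [h.eq, h1] at h2
    have h3 : jointMat F * jointMat E = 0 := by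
      rw [Int.cast_neg, Int.cast_one, neg_one_smul] at h2
      have h3 : (2 : ℂ) • (jointMat F * jointMat E) = 0 := by
        rw [two_smul, add_eq_zero_iff_eq_neg]
        exact h2
      exact (smul_eq_zero.1 h3).resolve_left two_ne_zero
    obtain ⟨z, hz, h4⟩ := exists_jointMat_mul F E
    rw [h3] at h4
    exact absurd h4.symm (smul_ne_zero (ne_zero_of_pow_four_eq_one hz) (jointMat_ne_zero _))

/-! ### Superoperators given by Kraus operators -/

section Kraus

variable {m n m' n' : Type} [Fintype m]

theorem conjBy_apply (V : Matrix n m ℂ) (ρ : Matrix m m ℂ) : conjBy V ρ = V * ρ * Vᴴ := rfl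

theorem conjBy_comp {l : Type} [Fintype l] [Fintype n] (V : Matrix l n ℂ) (W : Matrix n m ℂ) :
    conjBy V ∘ₗ conjBy W = conjBy (V * W) := by
  ext1 ρ
  simp [conjBy_apply, Matrix.mul_assoc, Matrix.conjTranspose_mul]

omit [Fintype m] in
theorem sum_comp_superOp {α l : Type} [Fintype α] (Φ : α → SuperOp m n) (Ψ : SuperOp l m) :
    (∑ a, Φ a) ∘ₗ Ψ = ∑ a, Φ a ∘ₗ Ψ := by
  refine LinearMap.ext fun ρ => ?_
  simp only [LinearMap.comp_apply, LinearMap.sum_apply]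

omit [Fintype m] in
theorem comp_sum_superOp {α l : Type} [Fintype α] (Φ : SuperOp m n) (Ψ : α → SuperOp l m) :
    Φ ∘ₗ (∑ a, Ψ a) = ∑ a, Φ ∘ₗ Ψ a := by
  refine LinearMap.ext fun ρ => ?_
  simp only [LinearMap.comp_apply, LinearMap.sum_apply, map_sum]

theorem conjBy_zero : conjBy (0 : Matrix n m ℂ) = 0 := by
  ext1 ρ
  simp [conjBy_apply]

theorem conjBy_smul_of_pow_eq_one {z : ℂ} (hz : z ^ 4 = 1) (V : Matrix n m ℂ) :
    conjBy (z • V) = conjBy V := by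
  have h : star z * z = 1 := by
    have h1 : ‖z‖ = 1 := Complex.norm_eq_one_of_pow_eq_one hz (by norm_num)
    have h2 := Complex.conj_mul' z
    rw [h1] at h2
    simpa using h2
  ext1 ρ
  simp only [conjBy_apply, Matrix.conjTranspose_smul, Matrix.smul_mul, Matrix.mul_smul,
    smul_smul, h, one_smul]

theorem conjBy_single_apply [DecidableEq m] (V : Matrix n m ℂ) (a b : m) (i j : n) :
    conjBy V (Matrix.single a b 1) i j = V i a * star (V j b) := by
  simp [conjBy_apply, Matrix.mul_apply, Matrix.single_apply, ite_and, Finset.sum_ite_eq]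

theorem conjBy_entry (V : Matrix n m ℂ) (ρ : Matrix m m ℂ) (i j : n) :
    conjBy V ρ i j = ∑ a, ∑ b, ρ a b * (V i a * star (V j b)) := by
  simp only [conjBy_apply, Matrix.mul_apply, Finset.sum_mul, Matrix.conjTranspose_apply]
  rw [Finset.sum_comm]
  exact Finset.sum_congr rfl fun a _ => Finset.sum_congr rfl fun b _ => by ring

variable [DecidableEq m] [Fintype n] [DecidableEq n]

theorem tensorOp_entry (Φ : SuperOp m m') (Ψ : SuperOp n n') (ρ : Matrix (m × n) (m × n) ℂ)
    (x y : m' × n') :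
    tensorOp Φ Ψ ρ x y = ∑ a, ∑ a', ∑ b, ∑ b', ρ (a, b) (a', b') *
      (Φ (Matrix.single a a' 1) x.1 y.1 * Ψ (Matrix.single b b' 1) x.2 y.2) := by
  simp [tensorOp, Matrix.sum_apply, Matrix.kroneckerMap_apply]

theorem tensorOp_conjBy (V : Matrix m' m ℂ) (W : Matrix n' n ℂ) :
    tensorOp (conjBy V) (conjBy W) = conjBy (V ⊗ₖ W) := by
  refine LinearMap.ext fun ρ => Matrix.ext fun x y => ?_
  simp only [tensorOp_entry, conjBy_single_apply]
  simp only [conjBy_entry, Fintype.sum_prod_type, Matrix.kroneckerMap_apply, star_mul']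
  refine Finset.sum_congr rfl fun a _ => ?_
  rw [Finset.sum_comm]
  refine Finset.sum_congr rfl fun b _ => Finset.sum_congr rfl fun a' _ =>
    Finset.sum_congr rfl fun b' _ => by ring

theorem tensorOp_sum_smul {α β : Type} [Fintype α] [Fintype β] (q : α → ℂ) (r : β → ℂ)
    (Φ : α → SuperOp m m') (Ψ : β → SuperOp n n') :
    tensorOp (∑ a, q a • Φ a) (∑ b, r b • Ψ b) =
      ∑ e : α × β, (q e.1 * r e.2) • tensorOp (Φ e.1) (Ψ e.2) := by
  refine LinearMap.ext fun ρ => Matrix.ext fun x y => ?_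
  simp only [tensorOp_entry, LinearMap.sum_apply, LinearMap.smul_apply, Matrix.sum_apply,
    Matrix.smul_apply, smul_eq_mul]
  symm
  simp only [Finset.mul_sum]
  rw [Finset.sum_comm]
  refine Finset.sum_congr rfl fun a _ => ?_
  rw [Finset.sum_comm]
  refine Finset.sum_congr rfl fun a' _ => ?_
  rw [Finset.sum_comm]
  refine Finset.sum_congr rfl fun b _ => ?_
  rw [Finset.sum_comm]
  refine Finset.sum_congr rfl fun b' _ => ?_
  rw [← Finset.mul_sum, ← Finset.mul_sum, Finset.sum_mul_sum, ← Fintype.sum_prod_type',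
    Finset.mul_sum]
  exact Finset.sum_congr rfl fun e _ => by ring

/-- The channel fidelity is the average of the entries of the Choi matrix over pairs of diagonal
indices. -/
theorem channelFidelity_eq [Nonempty m] (𝓔 : SuperOp m m) :
    channelFidelity 𝓔 =
      ((Fintype.card m : ℂ) ^ 2)⁻¹ * ∑ a, ∑ b, 𝓔 (Matrix.single a b 1) a b := by
  set r : ℂ := ((1 / √(Fintype.card m : ℝ) : ℝ) : ℂ) with hr
  have hrr : r * r = (Fintype.card m : ℂ)⁻¹ := by
    rw [hr, ← Complex.ofReal_mul, div_mul_div_comm, one_mul,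
      Real.mul_self_sqrt (Nat.cast_nonneg _)]
    simp
  have hstar : star r = r := Complex.conj_ofReal _
  have hM : ∀ x y : m × m, tensorOp LinearMap.id 𝓔
      (Matrix.vecMulVec (maxEntangled m) (star (maxEntangled m))) x y =
        r * r * 𝓔 (Matrix.single x.1 y.1 1) x.2 y.2 := by
    intro x y
    rw [tensorOp_entry, Fintype.sum_eq_single x.1, Fintype.sum_eq_single y.1,
      Fintype.sum_eq_single x.1, Fintype.sum_eq_single y.1]
    · simp [Matrix.vecMulVec_apply, maxEntangled, ← hr, hstar, -RCLike.star_def, -one_div]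
    all_goals
      intro z hz
      simp [Matrix.vecMulVec_apply, maxEntangled, hz, hz.symm]
  simp only [channelFidelity, dotProduct, Matrix.mulVec, hM, Fintype.sum_prod_type,
    maxEntangled, Pi.star_apply, ← hr, apply_ite star, hstar, star_zero, ite_mul, mul_ite,
    zero_mul, mul_zero, Finset.sum_ite_eq, Finset.mem_univ, if_true]
  rw [Finset.mul_sum]
  refine Finset.sum_congr rfl fun a _ => ?_
  rw [Finset.mul_sum, Finset.mul_sum]
  refine Finset.sum_congr rfl fun b _ => ?_
  rw [sq, mul_inv, ← hrr]
  ring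

theorem channelFidelity_sum_smul {α : Type} [Fintype α] [Nonempty m] (q : α → ℂ)
    (𝓔 : α → SuperOp m m) :
    channelFidelity (∑ a, q a • 𝓔 a) = ∑ a, q a * channelFidelity (𝓔 a) := by
  simp only [channelFidelity_eq, LinearMap.sum_apply, LinearMap.smul_apply, Matrix.sum_apply,
    Matrix.smul_apply, smul_eq_mul, Finset.mul_sum]
  rw [Finset.sum_congr rfl fun a _ => Finset.sum_comm, Finset.sum_comm]
  exact Finset.sum_congr rfl fun a _ => Finset.sum_congr rfl fun b _ =>
    Finset.sum_congr rfl fun b' _ => by ring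

theorem channelFidelity_conjBy [Nonempty m] (V : Matrix m m ℂ) :
    channelFidelity (conjBy V) = ((Fintype.card m : ℂ) ^ 2)⁻¹ * (V.trace * star V.trace) := by
  simp only [channelFidelity_eq, conjBy_single_apply, Matrix.trace, Matrix.diag_apply,
    star_sum, Finset.sum_mul_sum]

end Kraus

/-! ### The depolarizing noise as a mixture of Pauli errors -/

/-- The probability of a single-qubit Pauli error under the depolarizing channel. -/
def pauliProb (p : ℝ) (P : Pauli) : ℝ := if P = .I then 1 - 3 / 4 * p else 1 / 4 * p

theorem Pauli.sum_eq {M : Type} [AddCommMonoid M] (f : Pauli → M) :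
    ∑ P, f P = f .I + (f .X + (f .Y + f .Z)) := by
  have h : (Finset.univ : Finset Pauli) = {.I, .X, .Y, .Z} := rfl
  rw [h]
  simp

theorem depolarizing_eq (p : ℝ) :
    depolarizing p = ∑ P : Pauli, (pauliProb p P : ℂ) • conjBy P.mat := by
  have h : conjBy Pauli.I.mat = LinearMap.id := by
    ext1 ρ
    simp [conjBy_apply, Pauli.mat]
  rw [Pauli.sum_eq, h, depolarizing]
  simp only [pauliProb, reduceCtorEq, if_true, if_false, smul_add]
  have : p / 4 = 1 / 4 * p := by ring
  rw [this, add_assoc]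

theorem tensorPow_depolarizing (ι : Type) [Fintype ι] [DecidableEq ι] (p : ℝ) :
    tensorPow ι (depolarizing p) =
      ∑ P : ι → Pauli, ((∏ i, pauliProb p (P i) : ℝ) : ℂ) • conjBy (pauliMat P) := by
  refine LinearMap.ext fun ρ => ?_
  ext x x'
  have key : ∀ y y' : ι → Fin 2,
      ∏ i, depolarizing p (Matrix.single (y i) (y' i) 1) (x i) (x' i) =
        ∑ P : ι → Pauli, ((∏ i, pauliProb p (P i) : ℝ) : ℂ) *
          (pauliMat P x y * star (pauliMat P x' y')) := by
    intro y y'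
    simp only [depolarizing_eq, LinearMap.sum_apply, LinearMap.smul_apply, Matrix.sum_apply,
      Matrix.smul_apply, smul_eq_mul, conjBy_single_apply]
    rw [Fintype.prod_sum fun i P => (pauliProb p P : ℂ) *
      (P.mat (x i) (y i) * star (P.mat (x' i) (y' i)))]
    simp only [Finset.prod_mul_distrib, pauliMat, star_prod, Complex.ofReal_prod]
  simp only [tensorPow, LinearMap.coe_mk, AddHom.coe_mk, Matrix.of_apply, key,
    LinearMap.sum_apply, LinearMap.smul_apply, Matrix.sum_apply, Matrix.smul_apply, smul_eq_mul,
    conjBy_entry, Finset.mul_sum]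
  rw [Finset.sum_congr rfl fun a _ => Finset.sum_comm, Finset.sum_comm]
  refine Finset.sum_congr rfl fun a _ => Finset.sum_congr rfl fun a _ =>
    Finset.sum_congr rfl fun a _ => by ring

/-- The probability of a joint error operator. -/
def jointProb (pa pb : ℝ) (E : JointError n k c) : ℝ :=
  (∏ i, pauliProb pa (E.1 i)) * ∏ i, pauliProb pb (E.2 i)

theorem noise_eq (pa pb : ℝ) :
    noise n k c pa pb =
      ∑ E : JointError n k c, (jointProb pa pb E : ℂ) • conjBy (jointMat E) := by
  rw [noise, tensorPow_depolarizing, tensorPow_depolarizing, tensorOp_sum_smul]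
  refine Finset.sum_congr rfl fun E _ => ?_
  rw [tensorOp_conjBy, jointProb, Complex.ofReal_mul, jointMat_def]

theorem prod_pauliProb {ι : Type} [Fintype ι] [DecidableEq ι] (p : ℝ) (P : ι → Pauli) :
    ∏ i, pauliProb p (P i) = errorProb (Fintype.card ι) p (weight P) := by
  have h : (Finset.univ.filter fun i => P i = Pauli.I).card =
      Fintype.card ι - weight P := by
    have := Finset.card_filter_add_card_filter_not (s := Finset.univ) (fun i => P i = Pauli.I)
    rw [Finset.card_univ] at this
    simp only [weight, ne_eq]
    omega
  simp only [pauliProb, Finset.prod_ite, Finset.prod_const, h]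
  rfl

theorem card_alice (h : k + c ≤ n) : Fintype.card (Alice n k c) = n := by
  simp
  omega

theorem jointProb_eq (h : k + c ≤ n) (pa pb : ℝ) (E : JointError n k c) :
    jointProb pa pb E = errorProb n pa (weight E.1) * errorProb c pb (weight E.2) := by
  rw [jointProb, prod_pauliProb, prod_pauliProb, card_alice h, Fintype.card_fin]

theorem weight_le_card {ι : Type} [Fintype ι] [DecidableEq ι] (P : ι → Pauli) :
    weight P ≤ Fintype.card ι := Finset.card_le_univ _

/-- Collecting the error operators of a set by weight. -/
theorem sum_jointProb_mem (h : k + c ≤ n) (pa pb : ℝ) (S : Set (JointError n k c))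
    [DecidablePred (· ∈ S)] :
    ∑ E, jointProb pa pb E * (if E ∈ S then 1 else 0) =
      ∑ w ∈ Finset.range (n + 1), ∑ w' ∈ Finset.range (c + 1),
        ({E ∈ S | weight E.1 = w ∧ weight E.2 = w'}.ncard : ℝ) *
          errorProb n pa w * errorProb c pb w' := by
  rw [← Finset.sum_product', ← Finset.sum_fiberwise_of_maps_to
    (g := fun E : JointError n k c => (weight E.1, weight E.2))
    (t := Finset.range (n + 1) ×ˢ Finset.range (c + 1))]
  · refine Finset.sum_congr rfl fun w _ => ?_
    have : {E ∈ S | weight E.1 = w.1 ∧ weight E.2 = w.2}.ncard =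
        (Finset.univ.filter fun E : JointError n k c =>
          (weight E.1, weight E.2) = w ∧ E ∈ S).card := by
      rw [← Set.ncard_coe_finset]
      congr 1
      ext E
      simp [Prod.ext_iff, and_comm]
    rw [this, mul_assoc, ← nsmul_eq_mul, ← Finset.sum_const, ← Finset.filter_filter,
      Finset.sum_filter (fun E => E ∈ S)]
    refine Finset.sum_congr rfl fun E hE => ?_
    rw [← (Finset.mem_filter.1 hE).2, jointProb_eq h, mul_ite, mul_one, mul_zero]
  · intro E _
    have h1 := weight_le_card E.1
    have h2 := weight_le_card E.2
    rw [card_alice h] at h1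
    rw [Fintype.card_fin] at h2
    simp only [Finset.mem_product, Finset.mem_range]
    omega

open Code

/-! ### The code before the encoding unitary -/

/-- Sums over the computational basis of Alice's register. -/
theorem sum_alice (f : (Alice n k c → Fin 2) → ℂ) :
    ∑ x, f x = ∑ l, ∑ e, ∑ a, f (Sum.elim l (Sum.elim e a)) := by
  rw [← (Equiv.sumArrowEquivProdArrow _ _ _).symm.sum_comp, Fintype.sum_prod_type]
  refine Finset.sum_congr rfl fun l _ => ?_
  rw [← (Equiv.sumArrowEquivProdArrow _ _ _).symm.sum_comp, Fintype.sum_prod_type]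
  rfl

theorem initial_apply (l : Fin k → Fin 2) (e : Fin c → Fin 2) (a : Fin (n - k - c) → Fin 2)
    (b : Fin c → Fin 2) (y : Fin k → Fin 2) :
    initial n k c (Sum.elim l (Sum.elim e a), b) y =
      if l = y then (if e = b then (if a = 0 then ((1 / √2 : ℝ) : ℂ) ^ c else 0) else 0)
        else 0 := by
  simp only [initial, Matrix.of_apply, Sum.elim_inl, Sum.elim_inr, Finset.prod_ite_zero,
    Finset.prod_const, Finset.card_univ, Fintype.card_fin, Finset.mem_univ, true_imp_iff,
    funext_iff, Pi.zero_apply, ite_mul, mul_ite, one_mul, mul_one, zero_mul, mul_zero]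
  by_cases h1 : ∀ j, a j = 0 <;> by_cases h2 : ∀ i, e i = b i <;>
    by_cases h3 : ∀ i, l i = y i <;> simp only [h1, h2, h3, if_true, if_false, implies_true]

/-- Discarding the ebits and ancillas undoes the initial embedding. -/
theorem traceOut_conjBy_initial : traceOut n k c ∘ₗ conjBy (initial n k c) = LinearMap.id := by
  have hr : ((1 / √2 : ℝ) : ℂ) * star ((1 / √2 : ℝ) : ℂ) = 1 / 2 := by
    rw [RCLike.star_def, Complex.conj_ofReal, ← Complex.ofReal_mul, div_mul_div_comm, one_mul,
      Real.mul_self_sqrt (by norm_num)]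
    norm_num
  refine LinearMap.ext fun ρ => Matrix.ext fun y y' => ?_
  simp only [LinearMap.comp_apply, traceOut, LinearMap.coe_mk, AddHom.coe_mk, Matrix.of_apply,
    conjBy_entry, initial_apply, ite_mul, zero_mul, mul_ite, mul_zero, Finset.sum_ite_eq,
    Finset.mem_univ, if_true, apply_ite star, star_zero, star_pow, LinearMap.id_apply,
    Finset.sum_const_zero, Finset.sum_ite_eq', Finset.sum_ite_irrel]
  -- The `2 ^ c` basis states of the ebits contribute `(1 / 2) ^ c` each.
  rw [← mul_pow, hr, Finset.sum_const, Finset.card_univ, Fintype.card_fun, Fintype.card_fin,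
    Fintype.card_fin, nsmul_eq_mul, mul_left_comm, Nat.cast_pow, ← mul_pow]
  norm_num

/-- The error operators `L ⊗ V ⊗ W` on Alice's side and `V` on Bob's side: those that act in the
same way on the two halves of each ebit. -/
def codeLabel :
    (Fin k → Pauli) × (Fin c → Pauli) × (Fin (n - k - c) → Pauli) →* JointError n k c where
  toFun P := (Sum.elim P.1 (Sum.elim P.2.1 P.2.2), P.2.1)
  map_one' := by
    refine Prod.ext ?_ rfl
    ext (i | i | i) <;> rfl
  map_mul' P Q := by
    refine Prod.ext ?_ rfl
    ext (i | i | i) <;> rfl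

theorem pauliMat_swap {ι : Type} [Fintype ι] {V : ι → Pauli} (hV : ∀ i, V i ≠ .Y)
    (x y : ι → Fin 2) : pauliMat V x y = pauliMat V y x := by
  have h : ∀ P : Pauli, P ≠ .Y → ∀ i j, P.mat i j = P.mat j i := by
    intro P hP i j
    cases P <;> first | exact absurd rfl hP | skip
    all_goals fin_cases i <;> fin_cases j <;> simp [Pauli.mat]
  exact Finset.prod_congr rfl fun i _ => h _ (hV i) _ _

theorem pauliMat_apply_zero {ι : Type} [Fintype ι] [DecidableEq ι] {W : ι → Pauli}
    (hW : ∀ i, W i = .I ∨ W i = .Z) (x : ι → Fin 2) :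
    pauliMat W x 0 = if x = 0 then 1 else 0 := by
  have h : ∀ P : Pauli, P = .I ∨ P = .Z → ∀ i, P.mat i 0 = if i = 0 then 1 else 0 := by
    rintro P (rfl | rfl) i <;> fin_cases i <;> simp [Pauli.mat, Matrix.one_apply]
  simp only [pauliMat, Pi.zero_apply, fun i => h _ (hW i) (x i), Finset.prod_ite_zero,
    Finset.prod_const_one, Finset.mem_univ, true_imp_iff, funext_iff]

/-- An ebit is fixed by `Z ⊗ Z` and `X ⊗ X`, and an ancilla by `Z`, while the logical part acts on
the information qubits only. The label `Y` is excluded because `Y ⊗ Y` changes the sign of an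
ebit. -/
theorem codeLabel_mul_initial (L : Fin k → Pauli) {V : Fin c → Pauli}
    {W : Fin (n - k - c) → Pauli} (hV : ∀ i, V i ≠ .Y) (hW : ∀ j, W j = .I ∨ W j = .Z) :
    jointMat (codeLabel (L, V, W)) * initial n k c = initial n k c * pauliMat L := by
  refine Matrix.ext fun x y => ?_
  obtain ⟨x, b⟩ := x
  obtain ⟨l, e, a, rfl⟩ : ∃ l e a, x = Sum.elim l (Sum.elim e a) :=
    ⟨_, _, _, by rw [Sum.elim_comp_inl_inr, Sum.elim_comp_inl_inr]⟩
  have hP : ∀ l' e' a' b', jointMat (codeLabel (L, V, W)) (Sum.elim l (Sum.elim e a), b)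
      (Sum.elim l' (Sum.elim e' a'), b') =
        pauliMat L l l' * (pauliMat V e e' * pauliMat W a a') * pauliMat V b b' := by
    intro l' e' a' b'
    simp [jointMat_def, codeLabel, pauliMat, Matrix.kroneckerMap_apply, Fintype.prod_sum_type]
  have hVV : ∑ e', pauliMat V e e' * pauliMat V b e' = if e = b then 1 else 0 := by
    simp only [fun e' => pauliMat_swap hV b e']
    rw [← Matrix.mul_apply, pauliMat_mul_self, Matrix.one_apply]
  rw [Matrix.mul_apply, Matrix.mul_apply, Fintype.sum_prod_type, sum_alice]
  simp only [hP, initial_apply, mul_ite, ite_mul, mul_zero, zero_mul, Finset.sum_ite_eq,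
    Finset.mem_univ, if_true, Finset.sum_ite_eq', Finset.sum_ite_irrel, Finset.sum_const_zero,
    pauliMat_apply_zero hW]
  have hr : ∀ r : ℂ, ∑ e', pauliMat L l y * (pauliMat V e e' * 1) * pauliMat V b e' * r =
      if e = b then r * pauliMat L l y else 0 := by
    intro r
    rw [← Finset.sum_mul, ← mul_one (r * _), ← mul_zero (r * pauliMat L l y), ← mul_ite, ← hVV,
      Finset.mul_sum, Finset.sum_mul]
    exact Finset.sum_congr rfl fun e' _ => by ring
  rw [hr]
  split_ifs <;> rfl

/-- The labels of the stabilizer generators before the encoding unitary is applied. -/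
def baseGen : Gen n k c → JointError n k c
  | .inl i => codeLabel (1, Pi.mulSingle i Pauli.Z, 1)
  | .inr (.inl i) => codeLabel (1, Pi.mulSingle i Pauli.X, 1)
  | .inr (.inr j) => codeLabel (1, 1, Pi.mulSingle j Pauli.Z)

theorem baseGen_mul_initial (j : Gen n k c) :
    jointMat (baseGen j) * initial n k c = initial n k c := by
  have h1 : ∀ {r : ℕ} (i j : Fin r) (P Q : Pauli), Q ≠ P → Q ≠ 1 →
      (Pi.mulSingle i P : Fin r → Pauli) j ≠ Q := by
    intro r i j P Q h h'
    rw [Pi.mulSingle_apply]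
    split_ifs
    exacts [h.symm, h'.symm]
  have h2 : ∀ {r : ℕ} (i j : Fin r), (Pi.mulSingle i Pauli.Z : Fin r → Pauli) j = .I ∨
      (Pi.mulSingle i Pauli.Z : Fin r → Pauli) j = .Z := by
    intro r i j
    rw [Pi.mulSingle_apply]
    split_ifs
    exacts [.inr rfl, .inl rfl]
  have h3 : initial n k c * pauliMat (1 : Fin k → Pauli) = initial n k c := by
    rw [pauliMat_one, Matrix.mul_one]
  rcases j with i | i | j
  · exact (codeLabel_mul_initial 1 (fun j => h1 i j _ _ (by decide) (by decide))
      fun _ => .inl rfl).trans h3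
  · exact (codeLabel_mul_initial 1 (fun j => h1 i j _ _ (by decide) (by decide))
      fun _ => .inl rfl).trans h3
  · exact (codeLabel_mul_initial 1 (fun j => by change Pauli.I ≠ _; decide)
      fun i => h2 j i).trans h3

/-- The stabilizer group of the code with trivial encoder. -/
def baseStabilizer (n k c : ℕ) : Subgroup (Matrix.unitaryGroup (Joint n k c) ℂ) :=
  Subgroup.closure (Set.range fun j => jointPauli (baseGen j))

theorem baseStabilizer_mul_initial {g : Matrix.unitaryGroup (Joint n k c) ℂ}
    (hg : g ∈ baseStabilizer n k c) : g.1 * initial n k c = initial n k c := by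
  induction hg using Subgroup.closure_induction with
  | mem g hg =>
    obtain ⟨j, rfl⟩ := hg
    exact baseGen_mul_initial j
  | one => exact Matrix.one_mul _
  | mul g h _ _ hg hh => 
    rw [Submonoid.coe_mul, Matrix.mul_assoc, hh, hg]
  | inv g _ hg =>
    have h : (g⁻¹).1 * g.1 = 1 := by
      rw [← Submonoid.coe_mul, inv_mul_cancel]
      rfl
    rw [← hg, ← Matrix.mul_assoc, h, Matrix.one_mul, hg]

/-- The labels of the error operators that lie, up to a phase, in the stabilizer group of the code
with trivial encoder. -/
def baseLabels (n k c : ℕ) : Submonoid (JointError n k c) where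
  carrier := {E | ∃ z : ℂ, z ^ 4 = 1 ∧ ∃ g ∈ baseStabilizer n k c, jointMat E = z • g.1}
  one_mem' := ⟨1, one_pow 4, 1, one_mem _, by rw [jointMat_one, one_smul]; rfl⟩
  mul_mem' := by
    rintro E F ⟨y, hy, g, hg, hE⟩ ⟨z, hz, h, hh, hF⟩
    obtain ⟨w, hw, hEF⟩ := exists_jointMat_mul E F
    have hw0 : w ≠ 0 := ne_zero_of_pow_four_eq_one hw
    refine ⟨w⁻¹ * (y * z), by rw [mul_pow, mul_pow, inv_pow, hw, hy, hz]; norm_num,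
      g * h, mul_mem hg hh, ?_⟩
    rw [mul_smul, Submonoid.coe_mul, ← smul_mul_smul_comm, ← hE, ← hF, hEF, smul_smul,
      inv_mul_cancel₀ hw0, one_smul]

theorem baseGen_mem_baseLabels (j : Gen n k c) : baseGen j ∈ baseLabels n k c :=
  ⟨1, one_pow 4, _, Subgroup.subset_closure ⟨j, rfl⟩, (one_smul _ _).symm⟩

theorem codeLabel_mem_baseLabels (V : Fin c → Pauli) {W : Fin (n - k - c) → Pauli}
    (hW : ∀ j, W j = .I ∨ W j = .Z) : codeLabel (1, V, W) ∈ baseLabels n k c := by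
  have hZ : ∀ i : Fin c, codeLabel (1, Pi.mulSingle i Pauli.Z, 1) ∈ baseLabels n k c :=
    fun i => baseGen_mem_baseLabels (.inl i)
  have hX : ∀ i : Fin c, codeLabel (1, Pi.mulSingle i Pauli.X, 1) ∈ baseLabels n k c :=
    fun i => baseGen_mem_baseLabels (.inr (.inl i))
  have hV1 : ∀ i P, codeLabel (1, Pi.mulSingle i P, 1) ∈ baseLabels n k c := by
    intro i P
    cases P
    · rw [← Pauli.one_eq, Pi.mulSingle_one]
      exact (codeLabel.map_one : codeLabel (1, 1, 1) = _) ▸ one_mem _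
    · exact hX i
    · -- `Y ⊗ Y` is, up to a phase, the product of `X ⊗ X` and `Z ⊗ Z`.
      have h := mul_mem (hX i) (hZ i)
      rw [← map_mul, Prod.mk_mul_mk, Prod.mk_mul_mk, ← Pi.mulSingle_mul, one_mul, one_mul] at h
      exact h
    · exact hZ i
  have hV2 : codeLabel (1, V, 1) ∈ baseLabels n k c := by
    have h : ((1, V, 1) : (Fin k → Pauli) × (Fin c → Pauli) × (Fin (n - k - c) → Pauli)) =
        ∏ i, (1, Pi.mulSingle i (V i), 1) := by
      refine Prod.ext ?_ (Prod.ext ?_ ?_) <;>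
        simp [Prod.fst_prod, Prod.snd_prod, Finset.univ_prod_mulSingle]
    rw [h, map_prod]
    exact Submonoid.prod_mem _ fun i _ => hV1 i _
  have hW2 : codeLabel (1, 1, W) ∈ baseLabels n k c := by
    have h : ((1, 1, W) : (Fin k → Pauli) × (Fin c → Pauli) × (Fin (n - k - c) → Pauli)) =
        ∏ i, (1, 1, Pi.mulSingle i (W i)) := by
      refine Prod.ext ?_ (Prod.ext ?_ ?_) <;>
        simp [Prod.fst_prod, Prod.snd_prod, Finset.univ_prod_mulSingle]
    rw [h, map_prod]
    refine Submonoid.prod_mem _ fun i _ => ?_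
    rcases hW i with h | h
    · rw [h, ← Pauli.one_eq, Pi.mulSingle_one]
      exact (codeLabel.map_one : codeLabel (1, 1, 1) = _) ▸ one_mem _
    · rw [h]
      exact baseGen_mem_baseLabels (.inr (.inr i))
  have h := mul_mem hV2 hW2
  rw [← map_mul, Prod.mk_mul_mk, Prod.mk_mul_mk, one_mul, one_mul, mul_one] at h
  exact h

theorem prod_sign_mulSingle {ι : Type} [Fintype ι] [DecidableEq ι] (P : ι → Pauli) (i : ι)
    (A : Pauli) : ∏ j, (P j).sign ((Pi.mulSingle i A : ι → Pauli) j) = (P i).sign A := by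
  rw [Fintype.prod_eq_single i, Pi.mulSingle_eq_same]
  intro j hj
  rw [Pi.mulSingle_eq_of_ne hj, Pauli.sign_one_right]

theorem jointSign_codeLabel (E : JointError n k c)
    (P : (Fin k → Pauli) × (Fin c → Pauli) × (Fin (n - k - c) → Pauli)) :
    jointSign E (codeLabel P) =
      ((∏ i, (E.1 (.inl i)).sign (P.1 i)) * ((∏ i, (E.1 (.inr (.inl i))).sign (P.2.1 i)) *
        ∏ i, (E.1 (.inr (.inr i))).sign (P.2.2 i))) * ∏ i, (E.2 i).sign (P.2.1 i) := by
  simp [jointSign, codeLabel, Fintype.prod_sum_type]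

/-- An error operator that commutes with the stabilizer generators is a logical operator times a
stabilizer element. -/
theorem exists_logical {E : JointError n k c} (hE : ∀ j, jointSign E (baseGen j) = 1) :
    ∃ (L : Fin k → Pauli) (z : ℂ), z ^ 4 = 1 ∧ ∃ g ∈ baseStabilizer n k c,
      jointMat E = z • (jointMat (codeLabel (L, 1, 1)) * g.1) := by
  have hone : ∀ {r : ℕ} (P : Fin r → Pauli),
      ∏ i, (P i).sign ((1 : Fin r → Pauli) i) = 1 := fun P =>
    Finset.prod_eq_one fun i _ => Pauli.sign_one_right _
  have h1 : ∀ P Q : Pauli, P.sign .Z * Q.sign .Z = 1 → P.sign .X * Q.sign .X = 1 → P = Q := by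
    decide
  have h2 : ∀ P : Pauli, P.sign .Z = 1 → P = .I ∨ P = .Z := by decide
  have hV : ∀ i, E.1 (.inr (.inl i)) = E.2 i := by
    intro i
    have hZ := hE (.inl i)
    have hX := hE (.inr (.inl i))
    simp only [baseGen, jointSign_codeLabel, hone, prod_sign_mulSingle, one_mul, mul_one]
      at hZ hX
    exact h1 _ _ hZ hX
  have hW : ∀ j, E.1 (.inr (.inr j)) = .I ∨ E.1 (.inr (.inr j)) = .Z := by
    intro j
    have hZ := hE (.inr (.inr j))
    simp only [baseGen, jointSign_codeLabel, hone, prod_sign_mulSingle, one_mul, mul_one] at hZ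
    exact h2 _ hZ
  obtain ⟨z, hz, g, hg, hzg⟩ := codeLabel_mem_baseLabels (k := k) E.2 hW
  let L : Fin k → Pauli := fun i => E.1 (.inl i)
  let W : Fin (n - k - c) → Pauli := fun j => E.1 (.inr (.inr j))
  have hsplit : codeLabel (L, 1, 1) * codeLabel (1, E.2, W) = E := by
    rw [← map_mul, Prod.mk_mul_mk, Prod.mk_mul_mk, one_mul, one_mul, mul_one]
    refine Prod.ext ?_ rfl
    ext (i | i | i)
    exacts [rfl, (hV i).symm, rfl]
  obtain ⟨y, hy, hmul⟩ := exists_jointMat_mul (codeLabel (L, 1, 1)) (codeLabel (1, E.2, W))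
  have hy0 : y ≠ 0 := ne_zero_of_pow_four_eq_one hy
  refine ⟨L, y⁻¹ * z, by rw [mul_pow, inv_pow, hy, hz]; norm_num, g, hg, ?_⟩
  rw [hzg, hsplit, Matrix.mul_smul] at hmul
  rw [mul_smul, hmul, smul_smul, inv_mul_cancel₀ hy0, one_smul]

/-! ### Conjugation by the encoding unitary -/

namespace Code

variable (C : Code n k c)

theorem UAB_inv : C.UAB⁻¹ = kronU C.U⁻¹ 1 := by
  rw [inv_eq_iff_mul_eq_one, UAB, kronU_mul, mul_inv_cancel, one_mul, kronU_one]

theorem gen_eq (j : Gen n k c) : C.gen j = C.UAB * jointPauli (baseGen j) * C.UAB⁻¹ := by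
  rw [UAB_inv, UAB, jointPauli, kronU_mul, kronU_mul, one_mul, mul_one]
  rcases j with i | i | j
  · simp only [gen, g', pauliAt_eq_mulSingle, baseGen, codeLabel, MonoidHom.coe_mk, OneHom.coe_mk,
      Sum.elim_mulSingle_one, Sum.elim_one_mulSingle]
  · simp only [gen, h', pauliAt_eq_mulSingle, baseGen, codeLabel, MonoidHom.coe_mk, OneHom.coe_mk,
      Sum.elim_mulSingle_one, Sum.elim_one_mulSingle]
  · simp only [gen, g', pauliAt_eq_mulSingle, baseGen, codeLabel, MonoidHom.coe_mk, OneHom.coe_mk,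
      Sum.elim_one_mulSingle, pauli_one]

theorem stabilizer_eq :
    C.stabilizer = (baseStabilizer n k c).map (MulAut.conj C.UAB).toMonoidHom := by
  rw [baseStabilizer, MonoidHom.map_closure, ← Set.range_comp, stabilizer]
  congr 2
  funext j
  exact C.gen_eq j

/-- As the encoding unitary conjugates Pauli operators to Pauli operators, and there are only
finitely many of them up to phases, every Pauli operator arises in this way. -/
theorem exists_conj_pauliMat (Q : Alice n k c → Pauli) :
    ∃ (z : ℂ) (P : Alice n k c → Pauli), z ^ 4 = 1 ∧
      (C.U⁻¹ * pauli Q * C.U).1 = z • pauliMat P := by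
  have h : ∀ P, ∃ (P' : Alice n k c → Pauli) (z : ℂ), z ^ 4 = 1 ∧
      (C.U * pauli P * C.U⁻¹).1 = z • pauliMat P' := by
    intro P
    obtain ⟨z, P', hz, h⟩ := C.clifford (pauli P) ⟨1, P, one_pow 4, (one_smul _ _).symm⟩
    exact ⟨P', z, hz, h⟩
  choose κ z hz hκ using h
  have hz0 : ∀ P, z P ≠ 0 := fun P => ne_zero_of_pow_four_eq_one (hz P)
  have hback : ∀ P, C.U⁻¹.1 * pauliMat (κ P) * C.U.1 = (z P)⁻¹ • pauliMat P := by
    intro P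
    have h1 : C.U⁻¹.1 * (C.U * pauli P * C.U⁻¹).1 * C.U.1 = pauliMat P := by
      rw [← Submonoid.coe_mul, ← Submonoid.coe_mul]
      have : C.U⁻¹ * (C.U * pauli P * C.U⁻¹) * C.U = pauli P := by group
      rw [this]
      rfl
    rw [← h1, hκ, Matrix.mul_smul, Matrix.smul_mul, smul_smul, inv_mul_cancel₀ (hz0 P), one_smul]
  have hinj : Function.Injective κ := by
    intro P P' hPP
    have h1 := hback P
    rw [hPP, hback P'] at h1
    refine eq_of_pauliMat_eq_smul (z := z P * (z P')⁻¹) ?_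
    rw [mul_smul, h1, smul_smul, mul_inv_cancel₀ (hz0 P), one_smul]
  obtain ⟨P, rfl⟩ := Finite.surjective_of_injective hinj Q
  exact ⟨(z P)⁻¹, P, by rw [inv_pow, hz, inv_one], hback P⟩

theorem exists_conj_jointMat (E : JointError n k c) :
    ∃ (z : ℂ) (P : JointError n k c), z ^ 4 = 1 ∧
      (C.UAB⁻¹ * jointPauli E * C.UAB).1 = z • jointMat P := by
  obtain ⟨z, P, hz, h⟩ := C.exists_conj_pauliMat E.1
  refine ⟨z, (P, E.2), hz, ?_⟩
  rw [UAB_inv, UAB, jointPauli, kronU_mul, kronU_mul, one_mul, mul_one, jointMat_def,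
    ← Matrix.smul_kronecker, ← h]
  rfl

/-- An error operator and a stabilizer generator commute or anticommute, because before the encoding
unitary they are Pauli operators. -/
theorem exists_sign (E : JointError n k c) (j : Gen n k c) :
    (C.gen j).1 * jointMat E = jointMat E * (C.gen j).1 ∨
      (C.gen j).1 * jointMat E = -(jointMat E * (C.gen j).1) := by
  obtain ⟨z, P, -, hP⟩ := C.exists_conj_jointMat E
  have hE : jointPauli E = C.UAB * (C.UAB⁻¹ * jointPauli E * C.UAB) * C.UAB⁻¹ := by group
  have h1 : C.gen j * jointPauli E =
      C.UAB * (jointPauli (baseGen j) * (C.UAB⁻¹ * jointPauli E * C.UAB)) * C.UAB⁻¹ := by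
    rw [gen_eq]; group
  have h2 : jointPauli E * C.gen j =
      C.UAB * ((C.UAB⁻¹ * jointPauli E * C.UAB) * jointPauli (baseGen j)) * C.UAB⁻¹ := by
    rw [gen_eq]; group
  have h1' := congrArg Subtype.val h1
  have h2' := congrArg Subtype.val h2
  simp only [Submonoid.coe_mul] at h1' h2' hP
  rw [h1', h2', hP, Matrix.mul_smul, jointMat_comm, Matrix.smul_mul z (jointMat P)]
  rcases jointSign_eq_or (baseGen j) P with h | h
  · left
    rw [h, Int.cast_one, one_smul]
  · right
    rw [h, Int.cast_neg, Int.cast_one, neg_one_smul, smul_neg, mul_neg, neg_mul]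

theorem commute_iff (E : JointError n k c) (j : Gen n k c) :
    Commute (jointPauli E) (C.gen j) ↔
      (C.gen j).1 * jointMat E = jointMat E * (C.gen j).1 := by
  rw [commute_iff_eq, eq_comm, Subtype.ext_iff]
  rfl

theorem exists_hasSyndrome (E : JointError n k c) : ∃ s, C.HasSyndrome E s := by
  classical
  refine ⟨fun j => if Commute (jointPauli E) (C.gen j) then 0 else 1, fun j => ?_⟩
  by_cases h : Commute (jointPauli E) (C.gen j) <;> simp [h]

variable {C}

theorem HasSyndrome.gen_mul {E : JointError n k c} {s : Syndrome n k c}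
    (h : C.HasSyndrome E s) (j : Gen n k c) :
    (C.gen j).1 * jointMat E = (-1 : ℂ) ^ (s j : ℕ) • (jointMat E * (C.gen j).1) := by
  by_cases hs : s j = 0
  · rw [hs, Fin.val_zero, pow_zero, one_smul]
    exact (C.commute_iff E j).1 ((h j).1 hs)
  · have hs1 : s j = 1 := by omega
    rw [hs1, Fin.val_one, pow_one, neg_one_smul]
    refine (C.exists_sign E j).resolve_left fun h1 => hs ?_
    exact (h j).2 ((C.commute_iff E j).2 h1)

variable (C)

/-- The encoding isometry. -/
def isometry : Matrix (Joint n k c) (Fin k → Fin 2) ℂ := C.UAB.1 * initial n k c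

theorem gen_mul_isometry (j : Gen n k c) : (C.gen j).1 * C.isometry = C.isometry := by
  have h : C.gen j * C.UAB = C.UAB * jointPauli (baseGen j) := by rw [gen_eq]; group
  rw [isometry, ← Matrix.mul_assoc, ← Submonoid.coe_mul, h, Submonoid.coe_mul,
    Matrix.mul_assoc, baseGen_mul_initial]

theorem stabilizer_mul_isometry {g : Matrix.unitaryGroup (Joint n k c) ℂ}
    (hg : g ∈ C.stabilizer) : g.1 * C.isometry = C.isometry := by
  rw [stabilizer_eq] at hg
  obtain ⟨g, hg, rfl⟩ := hg
  have h : (MulAut.conj C.UAB).toMonoidHom g * C.UAB = C.UAB * g := by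
    change C.UAB * g * C.UAB⁻¹ * C.UAB = _
    group
  rw [isometry, ← Matrix.mul_assoc, ← Submonoid.coe_mul, h, Submonoid.coe_mul,
    Matrix.mul_assoc, baseStabilizer_mul_initial hg]

theorem UAB_inv_mul_isometry : (C.UAB⁻¹).1 * C.isometry = initial n k c := by
  rw [isometry, ← Matrix.mul_assoc, ← Submonoid.coe_mul, inv_mul_cancel]
  exact Matrix.one_mul _

/-! ### Syndrome measurement and correction -/

theorem list_prod_mul_of_forall {m p α : Type} [Fintype m] [DecidableEq m]
    {f : α → Matrix m m ℂ} {M : Matrix m p ℂ} {l : List α} (h : ∀ a ∈ l, f a * M = M) :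
    (l.map f).prod * M = M := by
  induction l with
  | nil => exact Matrix.one_mul M
  | cons a l ih =>
    rw [List.map_cons, List.prod_cons, Matrix.mul_assoc,
      ih fun b hb => h b (List.mem_cons_of_mem a hb), h a List.mem_cons_self]

theorem list_prod_mul_eq_zero {m p α : Type} [Fintype m] [DecidableEq m]
    {f : α → Matrix m m ℂ} {M : Matrix m p ℂ} (h : ∀ a, f a * M = M ∨ f a * M = 0) {l : List α}
    (h0 : ∃ a ∈ l, f a * M = 0) : (l.map f).prod * M = 0 := by
  induction l with
  | nil => simp at h0
  | cons a l ih =>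
    rw [List.map_cons, List.prod_cons, Matrix.mul_assoc]
    by_cases hl : ∃ b ∈ l, f b * M = 0
    · rw [ih hl, Matrix.mul_zero]
    · have ha : f a * M = 0 := by
        obtain ⟨b, hb, hb0⟩ := h0
        rcases List.mem_cons.1 hb with rfl | hb
        exacts [hb0, absurd ⟨b, hb, hb0⟩ hl]
      rw [list_prod_mul_of_forall fun b hb => (h b).resolve_right fun hb0 => hl ⟨b, hb, hb0⟩, ha]

/-- The syndrome projectors pick out the syndrome of a joint eigenspace of the generators. -/
theorem proj_mul {p : Type} {M : Matrix (Joint n k c) p ℂ} {t : Syndrome n k c}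
    (hM : ∀ j, (C.gen j).1 * M = (-1 : ℂ) ^ (t j : ℕ) • M) (s : Syndrome n k c) :
    C.proj s * M = if s = t then M else 0 := by
  have hfac : ∀ j, C.projFactor s j * M = if s j = t j then M else 0 := by
    intro j
    have hc : ∀ a b : Fin 2, (1 / 2 : ℂ) * (1 + (-1) ^ (a : ℕ) * (-1) ^ (b : ℕ)) =
        if a = b then 1 else 0 := by
      intro a b
      fin_cases a <;> fin_cases b <;> norm_num
    rw [projFactor, Matrix.smul_mul, Matrix.add_mul, Matrix.one_mul, Matrix.smul_mul, hM,
      smul_smul]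
    nth_rw 1 [← one_smul ℂ M]
    rw [← add_smul, smul_smul, hc, ite_smul, one_smul, zero_smul]
  have hor : ∀ j, C.projFactor s j * M = M ∨ C.projFactor s j * M = 0 := by
    intro j
    rw [hfac]
    split_ifs
    exacts [.inl rfl, .inr rfl]
  rw [proj, Matrix.mul_assoc, Matrix.mul_assoc]
  split_ifs with hst
  · have h1 : ∀ j, C.projFactor s j * M = M := fun j => by rw [hfac, if_pos (congrFun hst j)]
    rw [list_prod_mul_of_forall fun j _ => h1 (.inr (.inr j)),
      list_prod_mul_of_forall fun j _ => h1 (.inr (.inl j)),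
      list_prod_mul_of_forall fun j _ => h1 (.inl j)]
  · -- The rightmost group of factors that contains a mismatch annihilates `M`.
    have hkill : ∀ {r : ℕ} (ι : Fin r → Gen n k c), (∃ i, s (ι i) ≠ t (ι i)) →
        ((List.finRange r).map fun i => C.projFactor s (ι i)).prod * M = 0 := by
      rintro r ι ⟨i, hi⟩
      exact list_prod_mul_eq_zero (fun i => hor _)
        ⟨i, List.mem_finRange i, by rw [hfac, if_neg hi]⟩
    have hkeep : ∀ {r : ℕ} (ι : Fin r → Gen n k c), (¬∃ i, s (ι i) ≠ t (ι i)) →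
        ((List.finRange r).map fun i => C.projFactor s (ι i)).prod * M = M := by
      intro r ι hι
      exact list_prod_mul_of_forall fun i _ => by
        rw [hfac, if_pos (not_not.1 fun h => hι ⟨i, h⟩)]
    by_cases h3 : ∃ j, s (.inr (.inr j)) ≠ t (.inr (.inr j))
    · rw [hkill (fun j => .inr (.inr j)) h3, Matrix.mul_zero, Matrix.mul_zero]
    rw [hkeep (fun j => .inr (.inr j)) h3]
    by_cases h2 : ∃ i, s (.inr (.inl i)) ≠ t (.inr (.inl i))
    · rw [hkill (fun i => .inr (.inl i)) h2, Matrix.mul_zero]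
    rw [hkeep (fun i => .inr (.inl i)) h2]
    refine hkill (fun i => .inl i) ?_
    obtain ⟨i | i | j, h⟩ := Function.ne_iff.1 hst
    exacts [⟨i, h⟩, absurd ⟨i, h⟩ h2, absurd ⟨j, h⟩ h3]

theorem decode_comp_conjBy {p : Type} [Fintype p] (R : Syndrome n k c → JointError n k c)
    {M : Matrix (Joint n k c) p ℂ} {t : Syndrome n k c}
    (hM : ∀ j, (C.gen j).1 * M = (-1 : ℂ) ^ (t j : ℕ) • M) :
    C.decode R ∘ₗ conjBy M =
      traceOut n k c ∘ₗ conjBy ((C.UAB⁻¹).1 * (jointMat (R t) * M)) := by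
  rw [decode, LinearMap.comp_assoc, sum_comp_superOp, Fintype.sum_eq_single t]
  · rw [conjBy_comp, Matrix.mul_assoc, C.proj_mul hM, if_pos rfl, Matrix.mul_assoc]
  · intro s hs
    rw [conjBy_comp, Matrix.mul_assoc, C.proj_mul hM, if_neg hs, Matrix.mul_zero, conjBy_zero]

theorem HasSyndrome.gen_mul_isometry {C : Code n k c} {E : JointError n k c}
    {s : Syndrome n k c} (h : C.HasSyndrome E s) (j : Gen n k c) :
    (C.gen j).1 * (jointMat E * C.isometry) = (-1 : ℂ) ^ (s j : ℕ) • (jointMat E * C.isometry) := by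
  rw [← Matrix.mul_assoc, h.gen_mul, Matrix.smul_mul, Matrix.mul_assoc, C.gen_mul_isometry]

theorem traceOut_conjBy_initial_mul {z : ℂ} (hz : z ^ 4 = 1)
    (V : Matrix (Fin k → Fin 2) (Fin k → Fin 2) ℂ) :
    traceOut n k c ∘ₗ conjBy (z • (initial n k c * V)) = conjBy V := by
  rw [conjBy_smul_of_pow_eq_one hz, ← conjBy_comp, ← LinearMap.comp_assoc,
    traceOut_conjBy_initial, LinearMap.id_comp]

/-- If an error operator is correctable, it acts on the code space as one of the representatives
does, and its effect is undone. -/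
theorem decode_correctable {R : Syndrome n k c → JointError n k c} (hR : C.IsSyndromeReps R)
    {E : JointError n k c} (hE : E ∈ C.correctable R) :
    C.decode R ∘ₗ conjBy (jointMat E * C.isometry) =
      conjBy (1 : Matrix (Fin k → Fin 2) (Fin k → Fin 2) ℂ) := by
  obtain ⟨_, ⟨s, rfl⟩, g, hg, z, hz, h⟩ := hE
  have hEW : jointMat E * C.isometry = z • (jointMat (R s) * C.isometry) := by
    rw [jointMat, h, Matrix.smul_mul, Matrix.mul_assoc, C.stabilizer_mul_isometry hg]
  rw [hEW, conjBy_smul_of_pow_eq_one hz,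
    C.decode_comp_conjBy R (hR.hasSyndrome s).gen_mul_isometry, ← Matrix.mul_assoc (jointMat _),
    jointMat_mul_self, Matrix.one_mul, UAB_inv_mul_isometry,
    ← traceOut_conjBy_initial_mul (n := n) (c := c) (one_pow 4), one_smul, Matrix.mul_one]

/-- An error operator that commutes with the generators acts on the code space as a logical Pauli
operator does. -/
theorem exists_logical_of_commute {F : JointError n k c}
    (hF : ∀ j, Commute (jointPauli F) (C.gen j)) :
    ∃ (L : Fin k → Pauli) (z : ℂ), z ^ 4 = 1 ∧ ∃ g ∈ baseStabilizer n k c,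
      (C.UAB⁻¹ * jointPauli F * C.UAB).1 = z • (jointMat (codeLabel (L, 1, 1)) * g.1) := by
  obtain ⟨z, P, hz, hP⟩ := C.exists_conj_jointMat F
  have hz0 : z ≠ 0 := ne_zero_of_pow_four_eq_one hz
  have hsign : ∀ j, jointSign P (baseGen j) = 1 := by
    intro j
    have h1 : C.UAB⁻¹ * jointPauli F * C.UAB * jointPauli (baseGen j) =
        jointPauli (baseGen j) * (C.UAB⁻¹ * jointPauli F * C.UAB) :=
      calc _ = C.UAB⁻¹ * (jointPauli F * C.gen j) * C.UAB := by rw [gen_eq]; group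
        _ = C.UAB⁻¹ * (C.gen j * jointPauli F) * C.UAB := by rw [(hF j).eq]
        _ = _ := by rw [gen_eq]; group
    have h2 : (C.UAB⁻¹ * jointPauli F * C.UAB).1 * jointMat (baseGen j) =
        jointMat (baseGen j) * (C.UAB⁻¹ * jointPauli F * C.UAB).1 := congrArg Subtype.val h1
    rw [hP] at h2
    exact jointSign_eq_one_of_commute ((Commute.smul_left_iff₀ hz0).1 h2)
  obtain ⟨L, x, hx, g, hg, hL⟩ := exists_logical hsign
  exact ⟨L, z * x, by rw [mul_pow, hz, hx, one_mul], g, hg, by rw [hP, hL, smul_smul]⟩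

variable {C} in
/-- The correction cancels the syndrome: after it, the error commutes with all the generators. -/
theorem IsSyndromeReps.commute {R : Syndrome n k c → JointError n k c}
    (hR : C.IsSyndromeReps R) {E : JointError n k c} {t : Syndrome n k c}
    (ht : C.HasSyndrome E t) (j : Gen n k c) : Commute (jointPauli (R t * E)) (C.gen j) := by
  obtain ⟨y, hy, hRE⟩ := exists_jointMat_mul (R t) E
  have hy0 : y ≠ 0 := ne_zero_of_pow_four_eq_one hy
  refine (C.commute_iff _ j).2 (smul_right_injective _ hy0 ?_)
  change y • _ = y • _
  rw [← Matrix.mul_smul, ← Matrix.smul_mul, ← hRE, ← Matrix.mul_assoc,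
    (hR.hasSyndrome t).gen_mul, Matrix.smul_mul, Matrix.mul_assoc, ht.gen_mul,
    Matrix.mul_smul, smul_smul, ← mul_pow, neg_one_mul, neg_neg, one_pow, one_smul,
    Matrix.mul_assoc]

/-- If an error operator is not correctable, decoding leaves a nontrivial logical Pauli error. -/
theorem decode_not_correctable {R : Syndrome n k c → JointError n k c}
    (hR : C.IsSyndromeReps R) {E : JointError n k c} (hE : E ∉ C.correctable R) :
    ∃ L : Fin k → Pauli, L ≠ 1 ∧
      C.decode R ∘ₗ conjBy (jointMat E * C.isometry) = conjBy (pauliMat L) := by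
  obtain ⟨t, ht⟩ := C.exists_hasSyndrome E
  obtain ⟨y, hy, hRE⟩ := exists_jointMat_mul (R t) E
  obtain ⟨L, z, hz, g, hg, hL⟩ := C.exists_logical_of_commute (hR.commute ht)
  have hyz : (y * z) ^ 4 = 1 := by rw [mul_pow, hy, hz, one_mul]
  have hL' : jointMat (R t * E) * C.UAB.1 =
      z • (C.UAB.1 * (jointMat (codeLabel (L, 1, 1)) * g.1)) := by
    have h : jointPauli (R t * E) * C.UAB =
        C.UAB * (C.UAB⁻¹ * jointPauli (R t * E) * C.UAB) := by group
    rw [← Matrix.mul_smul, ← hL]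
    exact congrArg Subtype.val h
  refine ⟨L, ?_, ?_⟩
  · rintro rfl
    have h1 : jointMat (codeLabel ((1, 1, 1) :
        (Fin k → Pauli) × (Fin c → Pauli) × (Fin (n - k - c) → Pauli))) = 1 :=
      (congrArg jointMat codeLabel.map_one).trans jointMat_one
    rw [h1, Matrix.one_mul] at hL'
    have h2 : C.UAB.1 * (C.UAB⁻¹).1 = 1 := congrArg Subtype.val (mul_inv_cancel C.UAB)
    have h3 : jointMat (R t * E) = z • (C.UAB.1 * g.1 * (C.UAB⁻¹).1) := by
      rw [← Matrix.smul_mul, ← hL', Matrix.mul_assoc, h2, Matrix.mul_one]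
    refine hE ⟨R t, ⟨t, rfl⟩, MulAut.conj C.UAB g, ?_, y * z, hyz, ?_⟩
    · rw [stabilizer_eq]
      exact ⟨g, hg, rfl⟩
    · change jointMat E = (y * z) • (jointMat (R t) * (C.UAB.1 * g.1 * (C.UAB⁻¹).1))
      rw [mul_smul, ← Matrix.mul_smul, ← h3, ← Matrix.mul_smul, ← hRE, ← Matrix.mul_assoc,
        jointMat_mul_self, Matrix.one_mul]
  · have h1 : jointMat (R t) * (jointMat E * C.isometry) =
        (y * z) • (C.UAB.1 * (initial n k c * pauliMat L)) := by
      rw [← Matrix.mul_assoc, hRE, isometry, Matrix.smul_mul, ← Matrix.mul_assoc, hL',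
        Matrix.smul_mul, smul_smul, Matrix.mul_assoc, Matrix.mul_assoc,
        baseStabilizer_mul_initial hg, codeLabel_mul_initial (V := 1) (W := 1) L
          (fun _ => by change Pauli.I ≠ _; decide) (fun _ => .inl rfl)]
    have h2 : (C.UAB⁻¹).1 * C.UAB.1 = 1 := congrArg Subtype.val (inv_mul_cancel C.UAB)
    rw [C.decode_comp_conjBy R ht.gen_mul_isometry, h1, Matrix.mul_smul, ← Matrix.mul_assoc, h2,
      Matrix.one_mul, traceOut_conjBy_initial_mul hyz]

theorem channelFidelity_error {R : Syndrome n k c → JointError n k c} (hR : C.IsSyndromeReps R)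
    (E : JointError n k c) [Decidable (E ∈ C.correctable R)] :
    channelFidelity (C.decode R ∘ₗ conjBy (jointMat E) ∘ₗ C.encode) =
      if E ∈ C.correctable R then 1 else 0 := by
  rw [encode, conjBy_comp, ← isometry]
  split_ifs with hE
  · rw [C.decode_correctable hR hE, channelFidelity_conjBy, Matrix.trace_one, star_natCast, ← sq,
      inv_mul_cancel₀ (pow_ne_zero 2 (Nat.cast_ne_zero.2 Fintype.card_ne_zero))]
  · obtain ⟨L, hL, h⟩ := C.decode_not_correctable hR hE
    rw [h, channelFidelity_conjBy, trace_pauliMat_of_ne hL, zero_mul, mul_zero]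

end Code

end EAQ

end

theorem theorem5 {n k c : ℕ} (C : EAQ.Code n k c)
    (R : EAQ.Syndrome n k c → EAQ.JointError n k c) (hR : C.IsSyndromeReps R)
    (pa pb : ℝ) (hpa : 0 ≤ pa ∧ pa ≤ 1) (hpb : 0 ≤ pb ∧ pb ≤ 1) :
    EAQ.channelFidelity (C.decode R ∘ₗ EAQ.noise n k c pa pb ∘ₗ C.encode) =
      ((∑ w ∈ Finset.range (n + 1), ∑ w' ∈ Finset.range (c + 1),
        (C.weightCount R w w' : ℝ) * EAQ.errorProb n pa w * EAQ.errorProb c pb w' : ℝ) : ℂ) := by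
  classical
  simp only [EAQ.Code.weightCount]
  rw [← EAQ.sum_jointProb_mem C.le, EAQ.noise_eq, EAQ.sum_comp_superOp, EAQ.comp_sum_superOp]
  simp only [LinearMap.smul_comp, LinearMap.comp_smul]
  rw [EAQ.channelFidelity_sum_smul, Complex.ofReal_sum]
  refine Finset.sum_congr rfl fun E _ => ?_
  rw [C.channelFidelity_error hR, Complex.ofReal_mul]
  split_ifs <;> simp
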